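/- Let $X=[0,1]$. Let $\mathcal L_{\sf H}$ be a one-sorted first-order language (home sort $\sf H$), and let $\mathcal L$ be the two-sorted language (sorts ${\sf H}$, ${\sf S}$) that contains $\mathcal L_{\sf H}$, a predicate symbol for each closed $C\subseteq X^n$ ($n\ge 1$), a function symbol for each continuous $f\colon X^n\to X$ ($n\ge 0$), and a set of further function symbols of sort ${\sf H}^n\to{\sf S}$ ($n\ge 1$), among them a symbol $d$ of sort ${\sf H}^2\to{\sf S}$. A *standard structure* is an $\mathcal L$-structure $\langle M,X\rangle$, written $M$, in which the sort ${\sf S}$ is $X$ with the obvious interpretation. Let $\mathcal F$ be the least set of formulas that contains all $\mathcal L_{\sf H}$-formulas and all formulas $t\in C$ ($C\subseteq X^n$ closed, $n\ge1$, $t$ an $n$-tuple of terms of sort $\sf S$) and is closed under $\wedge$, $\vee$ and the quantifiers $\forall,\exists$ of both sorts; $\mathcal F(A)$ is the set of such formulas with names for the elements of $A$. A map $f\colon M\to N$ is an *$\mathcal F$-elementary embedding* if $M\models\varphi(a)$ implies $N\models\varphi(fa)$ for all $\varphi\in\mathcal F$ and all tuples $a$ of $M$; for a substructure $N$ of $U$,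 $N\preccurlyeq^{\mathcal F}U$ means that the inclusion is such an embedding. $U$ is *$\mathcal F$-saturated* if every type $p(x;\eta)\subseteq\mathcal F(A)$ with $A\subseteq U$, $|A|<|U|$, that is finitely realized in $U$ is realized in $U$ ($x,\eta$ finite tuples of variables of sort ${\sf H}$ and ${\sf S}$). Let $\langle M,X\rangle$ be a standard structure in which $d$ is interpreted by a metric on $M$ with values in $[0,1]$ and all function symbols of $\mathcal L_{\sf H}$ and all function symbols of sort ${\sf H}^n\to{\sf S}$ are interpreted by functions that are uniformly continuous for this metric. Let $U$ be an uncountable $\mathcal F$-saturated standard structure into which $M$ embeds $\mathcal F$-elementarily. (Then $d$ is a pseudometric on $U$.) For $a,b\in U^n$ write $a\sim_{\sf S}b$ if $t(a,z)=t(b,z)$ for every parameter-free term $t(x,z)$ of sort ${\sf H}^{n+k}\to{\sf S}$, $k\in\omega$, and every $z\in U^k$. For $A\subseteq U$, a type $p(x)\subseteq\mathcal F(A)$, $|x|=n$ with $1\le n<\omega$, is a *Cauchy type* if the set $p(U)$ of its realizations in $U^n$ is nonempty and any two elements of $p(U)$ are $\sim_{\sf S}$-equivalent; it is *$\sim_{\sf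 S}$-invariant* if $p(U)$ is a union of $\sim_{\sf S}$-classes. The set $A$ is *Cauchy complete* if for every $\sim_{\sf S}$-invariant Cauchy type $p(x)\subseteq\mathcal F(A)$ there is $b\in A^{|x|}$ with $U\models p(b)$. **Proposition.** Let $N\preccurlyeq^{\mathcal F}U$ be a model which is small ($|N|<|U|$) or equal to $U$. Then the following are equivalent: 1. $N$ is Cauchy complete; 2. $N$ is $d$-Cauchy complete, that is, every $d$-Cauchy sequence in $N$ converges with respect to $d$ to a point of $N$. -/

import Mathlib

open scoped Cardinal

universe u v w x y z

/-- The data of a two-sorted language `L` (home sort `H`, space sort `S`) over a fixed space `X`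
that depend on the choice of the language: the one-sorted language `home` of the home sort, and the
function symbols of sort `H ^ (n + 1) → S` (so of every arity `≥ 1`). The symbols of the space sort
(closed subsets of `X ^ n` and continuous functions `X ^ n → X`) are the same for every language
and are built into terms and formulas below. -/
structure SpaceLanguage where
  home : FirstOrder.Language.{u, v}
  mixed : ℕ → Type w

namespace SpaceLanguage

/-- The interpretation of the symbols of sort `H ^ (n + 1) → S`. A standard structure `⟨M, X⟩`
is a type `M` with instances `[L.home.Structure M]` and `[L.MixedStructure X M]`. -/
class MixedStructure (L : SpaceLanguage.{u, v, w}) (X : Type x) (M : Type y) where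
  mixedMap : ∀ {n : ℕ}, L.mixed n → (Fin (n + 1) → M) → X

variable (L : SpaceLanguage.{u, v, w}) (X : Type x) [TopologicalSpace X]

/-- Terms of sort `S` with variables of sort `H` in `α` and variables of sort `S` in `β`.
The case `n = 0` of `func` provides a constant for each element of `X`. -/
inductive SpaceTerm (α : Type y) (β : Type z) : Type (max u w x y z)
  | var (i : β) : SpaceTerm α β
  | func {n : ℕ} (f : C(Fin n → X, X)) (ts : Fin n → SpaceTerm α β) : SpaceTerm α β
  | mixed {n : ℕ} (g : L.mixed n) (ts : Fin (n + 1) → L.home.Term α) : SpaceTerm α β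

/-- The class `F(A)` of formulas with names for the elements of `A` and with free variables among
`n` variables of sort `H` and `k` variables of sort `S`. -/
inductive FFormula (A : Type y) : ℕ → ℕ → Type (max u v w x y)
  /-- Every first-order formula of the home language. -/
  | home {n k : ℕ} (φ : L.home.Formula (A ⊕ Fin n)) : FFormula A n k
  /-- `(t_0, …, t_m) ∈ C` for a closed set `C`. -/
  | mem {n k m : ℕ} (t : Fin (m + 1) → SpaceTerm L X (A ⊕ Fin n) (Fin k))
      (C : TopologicalSpace.Closeds (Fin (m + 1) → X)) : FFormula A n k
  | and {n k : ℕ} (φ ψ : FFormula A n k) : FFormula A n k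
  | or {n k : ℕ} (φ ψ : FFormula A n k) : FFormula A n k
  | allH {n k : ℕ} (φ : FFormula A (n + 1) k) : FFormula A n k
  | exH {n k : ℕ} (φ : FFormula A (n + 1) k) : FFormula A n k
  | allS {n k : ℕ} (φ : FFormula A n (k + 1)) : FFormula A n k
  | exS {n k : ℕ} (φ : FFormula A n (k + 1)) : FFormula A n k

variable {L X}

section Semantics

variable {M : Type y} [L.home.Structure M] [L.MixedStructure X M]

/-- The value of a term of sort `S` in the standard structure `⟨M, X⟩`. -/
def SpaceTerm.eval {α : Type*} {β : Type*} (a : α → M) (ξ : β → X) :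
    SpaceTerm L X α β → X
  | .var i => ξ i
  | .func f ts => f fun i => (ts i).eval a ξ
  | .mixed g ts => MixedStructure.mixedMap g fun i => (ts i).realize a

/-- Truth of an `F`-formula in the standard structure `⟨M, X⟩`, where `ρ` interprets the names,
`a` the variables of sort `H` and `ξ` those of sort `S`. -/
def FFormula.Realize {A : Type*} (ρ : A → M) :
    ∀ {n k : ℕ}, FFormula L X A n k → (Fin n → M) → (Fin k → X) → Prop
  | _, _, .home φ, a, _ => φ.Realize (Sum.elim ρ a)
  | _, _, .mem t C, a, ξ => (fun i => (t i).eval (Sum.elim ρ a) ξ) ∈ C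
  | _, _, .and φ ψ, a, ξ => φ.Realize ρ a ξ ∧ ψ.Realize ρ a ξ
  | _, _, .or φ ψ, a, ξ => φ.Realize ρ a ξ ∨ ψ.Realize ρ a ξ
  | _, _, .allH φ, a, ξ => ∀ b : M, φ.Realize ρ (Fin.snoc a b) ξ
  | _, _, .exH φ, a, ξ => ∃ b : M, φ.Realize ρ (Fin.snoc a b) ξ
  | _, _, .allS φ, a, ξ => ∀ b : X, φ.Realize ρ a (Fin.snoc ξ b)
  | _, _, .exS φ, a, ξ => ∃ b : X, φ.Realize ρ a (Fin.snoc ξ b)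

end Semantics

variable (L X)

/-- `f : M → N` is an `F`-elementary embedding: `M ⊨ φ(a)` implies `N ⊨ φ(f a)` for every
`F`-formula `φ` and every tuple `a` of `M`. The instance `φ(a)` is a sentence of `F(M)`. -/
def IsFElementary {M : Type y} {N : Type z} [L.home.Structure M] [L.MixedStructure X M]
    [L.home.Structure N] [L.MixedStructure X N] (f : M → N) : Prop :=
  ∀ φ : FFormula L X M 0 0,
    φ.Realize id Fin.elim0 Fin.elim0 → φ.Realize f Fin.elim0 Fin.elim0

section Monster

variable {U : Type y} [L.home.Structure U] [L.MixedStructure X U]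

/-- The symbols of sort `H ^ (n + 1) → S` are interpreted in a substructure by restriction. -/
instance inducedMixedStructure (N : L.home.Substructure U) : L.MixedStructure X N where
  mixedMap g v := MixedStructure.mixedMap g fun i => (v i : U)

variable {L} in
/-- `N ≼^F U`. -/
def IsModel (N : L.home.Substructure U) : Prop :=
  IsFElementary L X (Subtype.val : N → U)

variable {L X} in
/-- The tuple `a` of elements of `U` satisfies in `U` all the formulas of the type `p(x)` over the
set `A` of parameters. -/
def Realizes {A : Set U} {n : ℕ} (p : Set (FFormula L X A n 0)) (a : Fin n → U) : Prop :=
  ∀ φ ∈ p, φ.Realize Subtype.val a Fin.elim0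

variable (U) in
/-- `F`-saturation: every type `p(x ; η)` with fewer than `|U|` parameters from `U` which is
finitely realized in `U` is realized in `U`. -/
def IsFSaturated : Prop :=
  ∀ (n k : ℕ) (A : Set U), #A < #U → ∀ p : Set (FFormula L X A n k),
    (∀ p₀ ⊆ p, p₀.Finite → ∃ (a : Fin n → U) (ξ : Fin k → X),
      ∀ φ ∈ p₀, φ.Realize Subtype.val a ξ) →
    ∃ (a : Fin n → U) (ξ : Fin k → X), ∀ φ ∈ p, φ.Realize Subtype.val a ξ

/-- `a ∼_S b`: for all parameter-free terms `t(x, z)` of sort `S` in which all variables have sort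
`H`, `∀ z, t(a, z) = t(b, z)` holds in `U`. -/
def SimS {n : ℕ} (a b : Fin n → U) : Prop :=
  ∀ (k : ℕ) (t : SpaceTerm L X (Fin n ⊕ Fin k) Empty) (c : Fin k → U),
    t.eval (Sum.elim a c) Empty.elim = t.eval (Sum.elim b c) Empty.elim

variable {L X}

/-- The set defined by the type `p(x)` is invariant under `∼_S`. -/
def IsSimInvariant {A : Set U} {n : ℕ} (p : Set (FFormula L X A n 0)) : Prop :=
  ∀ a b : Fin n → U, SimS L X a b → (Realizes p a ↔ Realizes p b)

/-- `p(x)` is a Cauchy type: it is consistent and `p(x) ∧ p(y) → x ∼_S y`. -/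
def IsCauchyType {A : Set U} {n : ℕ} (p : Set (FFormula L X A n 0)) : Prop :=
  (∃ a : Fin n → U, Realizes p a) ∧
    ∀ a b : Fin n → U, Realizes p a → Realizes p b → SimS L X a b

variable (L X) in
/-- Every `∼_S`-invariant Cauchy type over `A`, in a nonempty finite tuple of variables, is realized
by a tuple of elements of `A`. -/
def IsCauchyComplete (A : Set U) : Prop :=
  ∀ n : ℕ, 1 ≤ n → ∀ p : Set (FFormula L X A n 0), IsCauchyType p → IsSimInvariant p →
    ∃ b : Fin n → A, Realizes p fun i => (b i : U)

end Monster

section Metric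

open unitInterval

variable {L}

/-- The value `d(a, b)`, as a real number, of a symbol `d` of sort `H ^ 2 → S` for `X = [0, 1]`. -/
def distVal {M : Type y} [L.MixedStructure I M] (d : L.mixed 1) (a b : M) : ℝ :=
  (MixedStructure.mixedMap d ![a, b] : I)

/-- The standard structure `⟨M, [0, 1]⟩` is a bounded metric structure: `d` is interpreted by the
metric of `M`, and all function symbols of sort `H ^ n → H` and `H ^ n → S` are interpreted by
uniformly continuous functions (finite powers carry the supremum metric). -/
structure IsMetricStructure (M : Type y) [MetricSpace M] [L.home.Structure M]
    [L.MixedStructure I M] (d : L.mixed 1) : Prop where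
  dist_eq : ∀ a b : M, distVal d a b = dist a b
  home_uniformContinuous : ∀ (n : ℕ) (f : L.home.Functions n),
    UniformContinuous fun a : Fin n → M => FirstOrder.Language.Structure.funMap f a
  mixed_uniformContinuous : ∀ (n : ℕ) (g : L.mixed n),
    UniformContinuous fun a : Fin (n + 1) → M => (MixedStructure.mixedMap g a : I)

/-- Every `d`-Cauchy sequence of elements of `A` converges, with respect to `d`, to an element
of `A`. -/
def IsDistComplete {U : Type y} [L.MixedStructure I U] (d : L.mixed 1) (A : Set U) : Prop :=
  ∀ s : ℕ → A,
    (∀ ε : ℝ, 0 < ε → ∃ K : ℕ, ∀ i ≥ K, ∀ j ≥ K, distVal d (s i : U) (s j : U) < ε) →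
    ∃ b : A, ∀ ε : ℝ, 0 < ε → ∃ K : ℕ, ∀ i ≥ K, distVal d (s i : U) (b : U) < ε

end Metric

end SpaceLanguage

/-!
The moduli of uniform continuity of the symbols, which hold in `M`, are expressible by formulas
of `F` and so pass to `U`. It follows that terms of sort `S` do not distinguish points of `U` at
distance `0`, and since `d` itself is such a term, `a ∼_S b` holds exactly when `d(a_i, b_i) = 0`
for all `i` (`simS_iff`).

If `N` is Cauchy complete and `s` is a `d`-Cauchy sequence in `N`, then the countably many formulas
`d(x, s_{K m}) ≤ 1 / (m + 1)`, for suitable indices `K m`, form a `∼_S`-invariant Cauchy type: it is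
consistent because `U` is saturated and uncountable, and its realizations are the limits of `s`.

If `N` is `d`-Cauchy complete and `a` realizes a `∼_S`-invariant Cauchy type `p` over `N`, then it
is enough to find tuples of `N` arbitrarily near to `a`: they converge coordinatewise to a tuple of
`N`, which is `∼_S`-equivalent to `a` and hence realizes `p`. The class `F` is not closed under
negation, so truth need not pass from `U` down to `N`. It does, however, after every closed set in
the formula is replaced by its closed `ε`-thickening (`IsFElementary.thick_of_realize`), because
`F` contains a formula `farNeg ε φ` incompatible with `φ` that holds wherever the thickening of `φ`
fails. On the other side, saturation makes a formula equivalent in `U` to the conjunction of its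
thickenings (`IsFSaturated.realize_of_forall_thick`). Together they give the approximation of `a`
(`IsCauchyType.exists_near`).
-/

namespace SpaceLanguage

open unitInterval Filter

/-! ### Renaming of names, conjunctions and closures of formulas -/

section Formulas

variable {L : SpaceLanguage.{u, v, w}} {X : Type x} [TopologicalSpace X]

/-- Renaming of the variables of sort `H` in a term of sort `S`. -/
def SpaceTerm.relabelHome {α : Type*} {α' : Type*} {β : Type*} (g : α → α') :
    SpaceTerm L X α β → SpaceTerm L X α' β
  | .var i => .var i
  | .func f ts => .func f fun i => (ts i).relabelHome g
  | .mixed h ts => .mixed h fun i => (ts i).relabel g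

/-- Replacement of the names of the elements of `A` by names in `B`. -/
def FFormula.mapNames {A : Type*} {B : Type*} (g : A → B) :
    ∀ {n k : ℕ}, FFormula L X A n k → FFormula L X B n k
  | _, _, .home φ => .home (φ.relabel (Sum.map g id))
  | _, _, .mem t C => .mem (fun i => (t i).relabelHome (Sum.map g id)) C
  | _, _, .and φ ψ => .and (φ.mapNames g) (ψ.mapNames g)
  | _, _, .or φ ψ => .or (φ.mapNames g) (ψ.mapNames g)
  | _, _, .allH φ => .allH (φ.mapNames g)
  | _, _, .exH φ => .exH (φ.mapNames g)
  | _, _, .allS φ => .allS (φ.mapNames g)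
  | _, _, .exS φ => .exS (φ.mapNames g)

/-- The conjunction of a list of formulas. -/
def FFormula.listAnd {A : Type*} {n k : ℕ} : List (FFormula L X A n k) → FFormula L X A n k
  | [] => .home ⊤
  | φ :: l => .and φ (listAnd l)

/-- Universal closure with respect to the variables of sort `H`. -/
def FFormula.allHs {A : Type*} {k : ℕ} : ∀ {n : ℕ}, FFormula L X A n k → FFormula L X A 0 k
  | 0, φ => φ
  | _ + 1, φ => allHs (.allH φ)

/-- Existential closure with respect to the variables of sort `H`. -/
def FFormula.exHs {A : Type*} {k : ℕ} : ∀ {n : ℕ}, FFormula L X A n k → FFormula L X A 0 k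
  | 0, φ => φ
  | _ + 1, φ => exHs (.exH φ)

/-- The formula stating that the `i`-th variable of sort `H` is the element named by `c`. -/
def FFormula.eqName {A : Type*} {n k : ℕ} (i : Fin n) (c : A) : FFormula L X A n k :=
  .home (FirstOrder.Language.Term.equal (.var (.inr i)) (.var (.inl c)))

variable {M : Type y} [L.home.Structure M] [L.MixedStructure X M]

theorem SpaceTerm.eval_relabelHome {α : Type*} {α' : Type*} {β : Type*} (g : α → α')
    (t : SpaceTerm L X α β) (a : α' → M) (ξ : β → X) :
    (t.relabelHome g).eval a ξ = t.eval (a ∘ g) ξ := by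
  induction t with
  | var i => rfl
  | func f ts ih => simp only [relabelHome, eval, ih]
  | mixed h ts => simp only [relabelHome, eval, FirstOrder.Language.Term.realize_relabel]

theorem FFormula.realize_mapNames {A : Type*} {B : Type*} (g : A → B) (ρ : B → M) {n k : ℕ}
    (φ : FFormula L X A n k) (a : Fin n → M) (ξ : Fin k → X) :
    (φ.mapNames g).Realize ρ a ξ ↔ φ.Realize (ρ ∘ g) a ξ := by
  have key {n : ℕ} (a : Fin n → M) : Sum.elim ρ a ∘ Sum.map g id = Sum.elim (ρ ∘ g) a := by
    rw [Sum.elim_comp_map, Function.comp_id]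
  induction φ with
  | home φ => simp only [mapNames, Realize, FirstOrder.Language.Formula.realize_relabel, key]
  | mem t C => simp only [mapNames, Realize, SpaceTerm.eval_relabelHome, key]
  | and φ ψ ih₁ ih₂ | or φ ψ ih₁ ih₂ => simp only [mapNames, Realize, ih₁, ih₂]
  | allH φ ih | exH φ ih | allS φ ih | exS φ ih => simp only [mapNames, Realize, ih]

theorem FFormula.realize_listAnd {A : Type*} (ρ : A → M) {n k : ℕ}
    (l : List (FFormula L X A n k)) (a : Fin n → M) (ξ : Fin k → X) :
    (listAnd l).Realize ρ a ξ ↔ ∀ φ ∈ l, φ.Realize ρ a ξ := by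
  induction l with
  | nil => simp [listAnd, Realize]
  | cons φ l ih => simp [listAnd, Realize, ih]

theorem FFormula.realize_allHs {A : Type*} (ρ : A → M) {n k : ℕ}
    (φ : FFormula L X A n k) (ξ : Fin k → X) :
    φ.allHs.Realize ρ Fin.elim0 ξ ↔ ∀ a : Fin n → M, φ.Realize ρ a ξ := by
  induction n with
  | zero => exact ⟨fun h a => Subsingleton.elim Fin.elim0 a ▸ h, fun h => h _⟩
  | succ n ih =>
    refine (ih _).trans ⟨fun h a => ?_, fun h a b => h _⟩
    simpa using h (Fin.init a) (a (Fin.last n))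

theorem FFormula.realize_exHs {A : Type*} (ρ : A → M) {n k : ℕ}
    (φ : FFormula L X A n k) (ξ : Fin k → X) :
    φ.exHs.Realize ρ Fin.elim0 ξ ↔ ∃ a : Fin n → M, φ.Realize ρ a ξ := by
  induction n with
  | zero => exact ⟨fun h => ⟨_, h⟩, fun ⟨a, h⟩ => Subsingleton.elim a Fin.elim0 ▸ h⟩
  | succ n ih =>
    refine (ih _).trans ⟨fun ⟨a, b, h⟩ => ⟨_, h⟩, fun ⟨a, h⟩ => ⟨Fin.init a, a (Fin.last n), ?_⟩⟩
    simpa using h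

@[simp]
theorem FFormula.realize_eqName {A : Type*} (ρ : A → M) {n k : ℕ} (i : Fin n) (c : A)
    (a : Fin n → M) (ξ : Fin k → X) :
    (eqName i c : FFormula L X A n k).Realize ρ a ξ ↔ a i = ρ c := by
  simp [eqName, Realize]

end Formulas

/-! ### Elementary embeddings -/

section Elementary

variable {L : SpaceLanguage.{u, v, w}} {X : Type x} [TopologicalSpace X]
variable {M : Type y} [L.home.Structure M] [L.MixedStructure X M]
variable {N : Type z} [L.home.Structure N] [L.MixedStructure X N]

/-- Elementarity speaks of sentences with names only; a tuple of free variables is absorbed by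
`∃ x, x = a ∧ φ(x)`. -/
theorem IsFElementary.realize {f : M → N} (hf : IsFElementary L X f) {n : ℕ}
    {φ : FFormula L X M n 0} {a : Fin n → M} (h : φ.Realize id a Fin.elim0) :
    φ.Realize f (f ∘ a) Fin.elim0 := by
  have key := hf (FFormula.and φ (.listAnd (List.ofFn fun i => .eqName i (a i)))).exHs
  simp only [FFormula.realize_exHs, FFormula.Realize, FFormula.realize_listAnd,
    List.forall_mem_ofFn_iff, FFormula.realize_eqName] at key
  obtain ⟨b, hb, hba⟩ := key ⟨a, h, fun i => rfl⟩
  rwa [show b = f ∘ a from funext hba] at hb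

/-- Universally quantified closed conditions on terms are preserved. -/
theorem IsFElementary.forall_mem {f : M → N} (hf : IsFElementary L X f) {n m : ℕ}
    (t : Fin (m + 1) → SpaceTerm L X (M ⊕ Fin n) (Fin 0))
    (C : Set (Fin (m + 1) → X)) (hC : IsClosed C)
    (h : ∀ a : Fin n → M, (fun i => (t i).eval (Sum.elim id a) Fin.elim0) ∈ C)
    (a : Fin n → N) : (fun i => (t i).eval (Sum.elim f a) Fin.elim0) ∈ C := by
  have key := hf (FFormula.mem t ⟨C, hC⟩).allHs
  simp only [FFormula.realize_allHs] at key
  exact key h a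

end Elementary

/-! ### Approximations of formulas -/

section Approximation

variable {L : SpaceLanguage.{u, v, w}} {X : Type x} [PseudoEMetricSpace X]

/-- The formula obtained from `φ` by replacing every closed set by its closed `ε`-thickening. -/
def FFormula.thick {A : Type*} (ε : ℝ) : ∀ {n k : ℕ}, FFormula L X A n k → FFormula L X A n k
  | _, _, .home φ => .home φ
  | _, _, .mem t C => .mem t ⟨Metric.cthickening ε C, Metric.isClosed_cthickening⟩
  | _, _, .and φ ψ => .and (φ.thick ε) (ψ.thick ε)
  | _, _, .or φ ψ => .or (φ.thick ε) (ψ.thick ε)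
  | _, _, .allH φ => .allH (φ.thick ε)
  | _, _, .exH φ => .exH (φ.thick ε)
  | _, _, .allS φ => .allS (φ.thick ε)
  | _, _, .exS φ => .exS (φ.thick ε)

/-- The positive substitute for the negation of `φ`: connectives and quantifiers are dualized,
formulas of the home language are negated, and a closed set is replaced by the set of the points
at distance at least `ε` from it. -/
def FFormula.farNeg {A : Type*} (ε : ℝ) : ∀ {n k : ℕ}, FFormula L X A n k → FFormula L X A n k
  | _, _, .home φ => .home φ.not
  | _, _, .mem t C => .mem t ⟨{p | ENNReal.ofReal ε ≤ Metric.infEDist p C},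
      isClosed_le continuous_const Metric.continuous_infEDist⟩
  | _, _, .and φ ψ => .or (φ.farNeg ε) (ψ.farNeg ε)
  | _, _, .or φ ψ => .and (φ.farNeg ε) (ψ.farNeg ε)
  | _, _, .allH φ => .exH (φ.farNeg ε)
  | _, _, .exH φ => .allH (φ.farNeg ε)
  | _, _, .allS φ => .exS (φ.farNeg ε)
  | _, _, .exS φ => .allS (φ.farNeg ε)

theorem FFormula.thick_exHs {A : Type*} (ε : ℝ) {n k : ℕ} (φ : FFormula L X A n k) :
    φ.exHs.thick ε = (φ.thick ε).exHs := by
  induction n with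
  | zero => rfl
  | succ n ih => exact ih _

theorem FFormula.thick_listAnd {A : Type*} (ε : ℝ) {n k : ℕ} (l : List (FFormula L X A n k)) :
    (listAnd l).thick ε = listAnd (l.map (thick ε)) := by
  induction l with
  | nil => rfl
  | cons φ l ih => simp only [listAnd, thick, ih, List.map_cons]

variable {M : Type y} [L.home.Structure M] [L.MixedStructure X M]

theorem FFormula.realize_thick_mem {A : Type*} {ρ : A → M} {ε : ℝ} {n k m : ℕ}
    {t : Fin (m + 1) → SpaceTerm L X (A ⊕ Fin n) (Fin k)}
    {C : TopologicalSpace.Closeds (Fin (m + 1) → X)} {a : Fin n → M} {ξ : Fin k → X} :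
    ((FFormula.mem t C).thick ε).Realize ρ a ξ ↔
      Metric.infEDist (fun i => (t i).eval (Sum.elim ρ a) ξ) (C : Set (Fin (m + 1) → X)) ≤
        ENNReal.ofReal ε :=
  Iff.rfl

theorem FFormula.realize_farNeg_mem {A : Type*} {ρ : A → M} {ε : ℝ} {n k m : ℕ}
    {t : Fin (m + 1) → SpaceTerm L X (A ⊕ Fin n) (Fin k)}
    {C : TopologicalSpace.Closeds (Fin (m + 1) → X)} {a : Fin n → M} {ξ : Fin k → X} :
    ((FFormula.mem t C).farNeg ε).Realize ρ a ξ ↔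
      ENNReal.ofReal ε ≤
        Metric.infEDist (fun i => (t i).eval (Sum.elim ρ a) ξ) (C : Set (Fin (m + 1) → X)) :=
  Iff.rfl

theorem FFormula.Realize.thick_mono {A : Type*} {ρ : A → M} {ε δ : ℝ} (hεδ : ε ≤ δ) {n k : ℕ}
    {φ : FFormula L X A n k} {a : Fin n → M} {ξ : Fin k → X}
    (h : (φ.thick ε).Realize ρ a ξ) : (φ.thick δ).Realize ρ a ξ := by
  induction φ with
  | home φ => exact h
  | mem t C => exact Metric.cthickening_mono hεδ _ h
  | and φ ψ ih₁ ih₂ => exact ⟨ih₁ h.1, ih₂ h.2⟩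
  | or φ ψ ih₁ ih₂ => exact h.imp ih₁ ih₂
  | allH φ ih | allS φ ih => exact fun b => ih (h b)
  | exH φ ih | exS φ ih => exact h.imp fun b hb => ih hb

theorem FFormula.Realize.not_farNeg {A : Type*} {ρ : A → M} {ε : ℝ} (hε : 0 < ε) {n k : ℕ}
    {φ : FFormula L X A n k} {a : Fin n → M} {ξ : Fin k → X}
    (h : φ.Realize ρ a ξ) : ¬ (φ.farNeg ε).Realize ρ a ξ := by
  induction φ with
  | home φ => simpa [farNeg, Realize] using h
  | mem t C =>
    rw [realize_farNeg_mem, Metric.infEDist_zero_of_mem h, nonpos_iff_eq_zero,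
      ENNReal.ofReal_eq_zero]
    exact hε.not_ge
  | and φ ψ ih₁ ih₂ => exact fun h' => h'.elim (ih₁ h.1) (ih₂ h.2)
  | or φ ψ ih₁ ih₂ => exact fun h' => h.elim (fun h => ih₁ h h'.1) (fun h => ih₂ h h'.2)
  | allH φ ih | allS φ ih => exact fun ⟨b, hb⟩ => ih (h b) hb
  | exH φ ih | exS φ ih => exact fun h' => h.elim fun b hb => ih hb (h' b)

theorem FFormula.realize_thick_of_not_farNeg {A : Type*} {ρ : A → M} {ε : ℝ} {n k : ℕ}
    {φ : FFormula L X A n k} {a : Fin n → M} {ξ : Fin k → X}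
    (h : ¬ (φ.farNeg ε).Realize ρ a ξ) : (φ.thick ε).Realize ρ a ξ := by
  induction φ with
  | home φ => simpa [farNeg, thick, Realize] using h
  | mem t C => exact realize_thick_mem.2 (not_le.1 (mt realize_farNeg_mem.2 h)).le
  | and φ ψ ih₁ ih₂ => exact ⟨ih₁ fun h' => h (.inl h'), ih₂ fun h' => h (.inr h')⟩
  | or φ ψ ih₁ ih₂ => exact (not_and_or.1 h).imp ih₁ ih₂
  | allH φ ih | allS φ ih => exact fun b => ih fun h' => h ⟨b, h'⟩
  | exH φ ih | exS φ ih => exact (not_forall.1 h).imp fun b hb => ih hb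

variable {N : Type z} [L.home.Structure N] [L.MixedStructure X N]

/-- Truth of `F`-formulas passes down an elementary embedding up to an arbitrarily small
thickening: otherwise the positive formula `farNeg ε φ` would pass up. -/
theorem IsFElementary.thick_of_realize {f : M → N} (hf : IsFElementary L X f) {ε : ℝ} (hε : 0 < ε)
    {φ : FFormula L X M 0 0} (h : φ.Realize f Fin.elim0 Fin.elim0) :
    (φ.thick ε).Realize id Fin.elim0 Fin.elim0 :=
  FFormula.realize_thick_of_not_farNeg fun h' => h.not_farNeg hε (hf _ h')

end Approximation

/-! ### Saturation -/

section Saturation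

variable {L : SpaceLanguage.{u, v, w}}

section

variable {X : Type x} [TopologicalSpace X] [T1Space X]
variable {U : Type y} [L.home.Structure U] [L.MixedStructure X U]

/-- As `U` is uncountable, finitely many further parameters keep a set of parameters small. -/
theorem mk_range_sumElim_lt (hcard : ℵ₀ < #U) {A : Type*} {ρ : A → U} (hρ : #(Set.range ρ) < #U)
    {n : ℕ} (a : Fin n → U) : #(Set.range (Sum.elim ρ a)) < #U := by
  rw [Set.Sum.elim_range]
  refine (Cardinal.mk_union_le _ _).trans_lt (Cardinal.add_lt_of_lt hcard.le hρ ?_)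
  exact (Set.countable_range a).le_aleph0.trans_lt hcard

/-- Saturation for types in which some variables (those in `J` and `K`) are given prescribed
values; the equations expressing this are themselves `F`-formulas. -/
theorem IsFSaturated.exists_realize (hU : IsFSaturated L X U) (hcard : ℵ₀ < #U)
    {A : Type*} {ρ : A → U} (hρ : #(Set.range ρ) < #U) {n k : ℕ}
    (a : Fin n → U) (ξ : Fin k → X) (J : Set (Fin n)) (K : Set (Fin k))
    {ι : Type*} (φ : ι → FFormula L X A n k)
    (h : ∀ s : Finset ι, ∃ (b : Fin n → U) (η : Fin k → X), (∀ i ∈ J, b i = a i) ∧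
      (∀ j ∈ K, η j = ξ j) ∧ ∀ i ∈ s, (φ i).Realize ρ b η) :
    ∃ (b : Fin n → U) (η : Fin k → X), (∀ i ∈ J, b i = a i) ∧
      (∀ j ∈ K, η j = ξ j) ∧ ∀ i, (φ i).Realize ρ b η := by
  classical
  set B : Set U := Set.range (Sum.elim ρ a)
  let g : A → B := fun c => ⟨ρ c, .inl c, rfl⟩
  let F : (J ⊕ K) ⊕ ι → FFormula L X B n k := Sum.elim
    (Sum.elim (fun i => .eqName i ⟨a i, .inr i, rfl⟩)
      (fun j => .mem (fun _ : Fin 1 => .var j) ⟨{fun _ => ξ j}, isClosed_singleton⟩))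
    (fun i => (φ i).mapNames g)
  have hS (j : K) (b : Fin n → U) (η : Fin k → X) :
      (F (.inl (.inr j))).Realize Subtype.val b η ↔ η j = ξ j :=
    ⟨fun h => congrFun (Set.mem_singleton_iff.1 h) 0,
      fun h => Set.mem_singleton_iff.2 (funext fun _ => h)⟩
  have hH (i : J) (b : Fin n → U) (η : Fin k → X) :
      (F (.inl (.inl i))).Realize Subtype.val b η ↔ b i = a i :=
    FFormula.realize_eqName _ _ _ _ _
  have hι (i : ι) (b : Fin n → U) (η : Fin k → X) :
      (F (.inr i)).Realize Subtype.val b η ↔ (φ i).Realize ρ b η :=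
    FFormula.realize_mapNames _ _ _ _ _
  obtain ⟨b, η, hb⟩ := hU n k B (mk_range_sumElim_lt hcard hρ a) (Set.range F) fun p₀ hp₀ hfin => by
    rw [← Set.image_univ] at hp₀
    obtain ⟨s, -, hs, rfl⟩ := (Set.exists_subset_image_finite_and (p := (p₀ = ·))).1
      ⟨p₀, hp₀, hfin, rfl⟩
    obtain ⟨b, η, h₁, h₂, h₃⟩ := h (hs.toFinset.preimage Sum.inr Sum.inr_injective.injOn)
    refine ⟨b, η, ?_⟩
    rintro _ ⟨(⟨i | j⟩ | i), hi, rfl⟩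
    · exact (hH i b η).2 (h₁ i i.2)
    · exact (hS j b η).2 (h₂ j j.2)
    · exact (hι i b η).2 (h₃ i (by simpa using hi))
  exact ⟨b, η, fun i hi => (hH ⟨i, hi⟩ b η).1 (hb _ ⟨_, rfl⟩),
    fun j hj => (hS ⟨j, hj⟩ b η).1 (hb _ ⟨_, rfl⟩), fun i => (hι i b η).1 (hb _ ⟨_, rfl⟩)⟩

end

variable {X : Type x} [EMetricSpace X]
variable {U : Type y} [L.home.Structure U] [L.MixedStructure X U]

/-- In an `F`-saturated structure a formula is equivalent to the conjunction of its thickenings. -/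
theorem IsFSaturated.realize_of_forall_thick (hU : IsFSaturated L X U) (hcard : ℵ₀ < #U)
    {A : Type*} {ρ : A → U} (hρ : #(Set.range ρ) < #U) {n k : ℕ} {φ : FFormula L X A n k}
    {a : Fin n → U} {ξ : Fin k → X}
    (h : ∀ m : ℕ, (φ.thick (1 / (m + 1))).Realize ρ a ξ) : φ.Realize ρ a ξ := by
  have anti {m m' : ℕ} (h : m ≤ m') : (1 / (m' + 1) : ℝ) ≤ 1 / (m + 1) := by gcongr
  induction φ with
  | home φ => exact h 0
  | mem t C =>
    refine (Metric.mem_iff_infEDist_zero_of_closed C.isClosed).2 (nonpos_iff_eq_zero.1 ?_)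
    refine ge_of_tendsto' (x := atTop) ?_ fun m : ℕ => FFormula.realize_thick_mem.1 (h m)
    simpa using ENNReal.tendsto_ofReal (tendsto_one_div_add_atTop_nhds_zero_nat (𝕜 := ℝ))
  | and φ ψ ih₁ ih₂ => exact ⟨ih₁ fun m => (h m).1, ih₂ fun m => (h m).2⟩
  | or φ ψ ih₁ ih₂ =>
    by_contra hn
    obtain ⟨h₁, h₂⟩ := not_or.1 hn
    obtain ⟨m₁, h₁⟩ := not_forall.1 (mt ih₁ h₁)
    obtain ⟨m₂, h₂⟩ := not_forall.1 (mt ih₂ h₂)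
    exact (h (max m₁ m₂)).elim (fun h => h₁ (h.thick_mono (anti (le_max_left _ _))))
      (fun h => h₂ (h.thick_mono (anti (le_max_right _ _))))
  | allH φ ih | allS φ ih => exact fun b => ih fun m => h m b
  | exH φ ih =>
    -- all thickenings of the matrix are realized at once, with `a` and `ξ` kept fixed
    obtain ⟨b₀, -⟩ := h 0
    obtain ⟨b, η, hb, hη, hφ⟩ := hU.exists_realize hcard hρ (Fin.snoc a b₀) ξ
      (Set.range Fin.castSucc) Set.univ (fun m : ℕ => φ.thick (1 / (m + 1))) fun s => by
        obtain ⟨b, hb⟩ := h (s.sup id)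
        refine ⟨Fin.snoc a b, ξ, ?_, fun _ _ => rfl, fun m hm => ?_⟩
        · rintro _ ⟨i, rfl⟩
          simp
        · exact FFormula.Realize.thick_mono (anti (Finset.le_sup (f := id) hm)) hb
    obtain rfl : η = ξ := funext fun j => hη j trivial
    refine ⟨b (Fin.last _), ih fun m => ?_⟩
    rw [show a = Fin.init b from funext fun i => by simpa [Fin.init] using (hb _ ⟨i, rfl⟩).symm,
      Fin.snoc_init_self]
    exact hφ m
  | exS φ ih =>
    obtain ⟨x₀, -⟩ := h 0
    obtain ⟨b, η, hb, hη, hφ⟩ := hU.exists_realize hcard hρ a (Fin.snoc ξ x₀)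
      Set.univ (Set.range Fin.castSucc) (fun m : ℕ => φ.thick (1 / (m + 1))) fun s => by
        obtain ⟨x, hx⟩ := h (s.sup id)
        refine ⟨a, Fin.snoc ξ x, fun _ _ => rfl, ?_, fun m hm => ?_⟩
        · rintro _ ⟨i, rfl⟩
          simp
        · exact FFormula.Realize.thick_mono (anti (Finset.le_sup (f := id) hm)) hx
    obtain rfl : b = a := funext fun j => hb j trivial
    refine ⟨η (Fin.last _), ih fun m => ?_⟩
    rw [show ξ = Fin.init η from funext fun i => by simpa [Fin.init] using (hη _ ⟨i, rfl⟩).symm,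
      Fin.snoc_init_self]
    exact hφ m

end Saturation

/-! ### The pseudometric -/

section Metric

variable {L : SpaceLanguage.{u, v, w}} {d : L.mixed 1}

/-- The term `d(s, t)`. -/
def distTerm (d : L.mixed 1) {α : Type*} {β : Type*} (s t : L.home.Term α) :
    SpaceTerm L I α β :=
  .mixed d ![s, t]

section

variable {U : Type y} [L.home.Structure U] [L.MixedStructure I U]

@[simp]
theorem eval_distTerm {α : Type*} {β : Type*} (s t : L.home.Term α) (a : α → U) (ξ : β → I) :
    (((distTerm d s t : SpaceTerm L I α β).eval a ξ : I) : ℝ) =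
      distVal d (s.realize a) (t.realize a) := by
  simp only [distTerm, SpaceTerm.eval, distVal]
  congr 2
  funext i
  fin_cases i <;> rfl

end

theorem distVal_nonneg {U : Type y} [L.MixedStructure I U] (a b : U) : 0 ≤ distVal d a b :=
  (MixedStructure.mixedMap d ![a, b] : I).2.1

variable {M : Type x} [MetricSpace M] [L.home.Structure M] [L.MixedStructure I M]
variable {U : Type y} [L.home.Structure U] [L.MixedStructure I U]

theorem distVal_self (hM : IsMetricStructure M d) {f : M → U} (hf : IsFElementary L I f) (a : U) :
    distVal d a a = 0 := by
  have h := hf.forall_mem (n := 1) (m := 0)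
    (fun _ => distTerm d (.var (.inr 0)) (.var (.inr 0))) {p | (p 0 : ℝ) ≤ 0}
    (isClosed_le (by fun_prop) (by fun_prop)) (fun a => by simp [hM.dist_eq])
    (fun _ => a)
  exact le_antisymm (by simpa using h) (distVal_nonneg _ _)

theorem distVal_comm (hM : IsMetricStructure M d) {f : M → U} (hf : IsFElementary L I f)
    (a b : U) : distVal d a b = distVal d b a := by
  have h := hf.forall_mem (n := 2) (m := 1)
    ![distTerm d (.var (.inr 0)) (.var (.inr 1)), distTerm d (.var (.inr 1)) (.var (.inr 0))]
    {p | (p 0 : ℝ) = p 1} (isClosed_eq (by fun_prop) (by fun_prop))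
    (fun a => by simp [-SetLike.coe_eq_coe, hM.dist_eq, dist_comm]) ![a, b]
  simpa using h

theorem distVal_triangle (hM : IsMetricStructure M d) {f : M → U} (hf : IsFElementary L I f)
    (a b c : U) : distVal d a c ≤ distVal d a b + distVal d b c := by
  have h := hf.forall_mem (n := 3) (m := 2)
    ![distTerm d (.var (.inr 0)) (.var (.inr 2)), distTerm d (.var (.inr 0)) (.var (.inr 1)),
      distTerm d (.var (.inr 1)) (.var (.inr 2))]
    {p | (p 0 : ℝ) ≤ p 1 + p 2} (isClosed_le (by fun_prop) (by fun_prop))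
    (fun a => by simp [hM.dist_eq, dist_triangle]) ![a, b, c]
  simpa using h

/-- Transfer of one instance of a modulus of uniform continuity: if in `M` a closed condition `D`
on terms `T(x, y)` follows from `d(x, y) < δ`, then in `U` it follows from `d(x, y) = 0`. -/
theorem mem_of_distVal_eq_zero (hM : IsMetricStructure M d) {f : M → U}
    (hf : IsFElementary L I f) {n m : ℕ}
    (T : Fin (m + 1) → SpaceTerm L I (M ⊕ Fin (n + n)) (Fin 0)) {D : Set (Fin (m + 1) → I)}
    (hD : IsClosed D) {δ : ℝ} (hδ : 0 < δ)
    (hT : ∀ a b : Fin n → M, dist a b < δ →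
      (fun j => (T j).eval (Sum.elim id (Fin.append a b)) Fin.elim0) ∈ D)
    {a b : Fin n → U} (hab : ∀ i, distVal d (a i) (b i) = 0) :
    (fun j => (T j).eval (Sum.elim f (Fin.append a b)) Fin.elim0) ∈ D := by
  let t : Fin (n + m + 1) → SpaceTerm L I (M ⊕ Fin (n + n)) (Fin 0) :=
    Fin.append (n := m + 1)
      (fun i => distTerm d (.var (.inr (Fin.castAdd n i))) (.var (.inr (Fin.natAdd n i)))) T
  -- the implication is written as the disjunction of the closed conditions `δ ≤ d(x_i, y_i)` and `D`
  let C : Set (Fin (n + m + 1) → I) :=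
    (⋃ i : Fin n, {p | δ ≤ (p (Fin.castAdd (m + 1) i) : I)}) ∪
      {p | (fun j : Fin (m + 1) => p (Fin.natAdd n j)) ∈ D}
  have hC : IsClosed C := by
    refine (isClosed_iUnion_of_finite fun i => ?_).union (hD.preimage (by fun_prop))
    exact isClosed_le (by fun_prop) (by fun_prop)
  have h₁ (i : Fin n) : t (Fin.castAdd (m + 1) i) = _ := Fin.append_left _ _ i
  have h₂ (j : Fin (m + 1)) : t (Fin.natAdd n j) = _ := Fin.append_right _ _ j
  have hmem (p : Fin (n + m + 1) → I) :
      p ∈ C ↔ (∃ i : Fin n, δ ≤ (p (Fin.castAdd (m + 1) i) : ℝ)) ∨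
        (fun j : Fin (m + 1) => p (Fin.natAdd n j)) ∈ D := by
    simp only [C, Set.mem_union, Set.mem_iUnion, Set.mem_ofPred_eq]
  have h := hf.forall_mem t C hC (fun c => ?_) (Fin.append a b)
  · simp only [hmem, h₁, h₂, eval_distTerm, FirstOrder.Language.Term.realize_var, Sum.elim_inr,
      Fin.append_left, Fin.append_right] at h
    exact h.resolve_left fun ⟨i, hi⟩ => hδ.not_ge (hab i ▸ hi)
  · rw [← Fin.append_castAdd_natAdd (f := c)]
    simp only [hmem, h₁, h₂, eval_distTerm, FirstOrder.Language.Term.realize_var, Sum.elim_inr,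
      Fin.append_left, Fin.append_right, hM.dist_eq]
    refine or_iff_not_imp_left.2 fun hn => hT _ _ ((dist_pi_lt_iff hδ).2 fun i => ?_)
    exact not_le.1 fun h => hn ⟨i, h⟩

theorem distVal_funMap_eq_zero (hM : IsMetricStructure M d) {f : M → U}
    (hf : IsFElementary L I f) {n : ℕ} (g : L.home.Functions n) {a b : Fin n → U}
    (hab : ∀ i, distVal d (a i) (b i) = 0) :
    distVal d (FirstOrder.Language.Structure.funMap g a)
      (FirstOrder.Language.Structure.funMap g b) = 0 := by
  refine le_antisymm (le_of_forall_pos_le_add fun ε hε => ?_) (distVal_nonneg _ _)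
  obtain ⟨δ, hδ, h⟩ := Metric.uniformContinuous_iff.1 (hM.home_uniformContinuous n g) ε hε
  have := mem_of_distVal_eq_zero hM hf (m := 0)
    (fun _ => distTerm d (.func g fun i => .var (.inr (Fin.castAdd n i)))
      (.func g fun i => .var (.inr (Fin.natAdd n i))))
    (D := {p | (p 0 : ℝ) ≤ 0 + ε}) (isClosed_le (by fun_prop) (by fun_prop)) hδ
    (fun a b hab => by simpa [-Fin.natAdd_eq_addNat, hM.dist_eq] using (h hab).le) hab
  simpa [-Fin.natAdd_eq_addNat] using this

theorem mixedMap_eq_of_distVal_eq_zero (hM : IsMetricStructure M d) {f : M → U}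
    (hf : IsFElementary L I f) {n : ℕ} (g : L.mixed n) {a b : Fin (n + 1) → U}
    (hab : ∀ i, distVal d (a i) (b i) = 0) :
    (MixedStructure.mixedMap g a : I) = MixedStructure.mixedMap g b := by
  refine dist_le_zero.1 (le_of_forall_pos_le_add fun ε hε => ?_)
  obtain ⟨δ, hδ, h⟩ := Metric.uniformContinuous_iff.1 (hM.mixed_uniformContinuous n g) ε hε
  have := mem_of_distVal_eq_zero hM hf (m := 1)
    ![.mixed g fun i => .var (.inr (Fin.castAdd (n + 1) i)),
      .mixed g fun i => .var (.inr (Fin.natAdd (n + 1) i))]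
    (D := {p | dist (p 0) (p 1) ≤ 0 + ε}) (isClosed_le (by fun_prop) (by fun_prop)) hδ
    (fun a b hab => by simpa [-Fin.natAdd_eq_addNat, SpaceTerm.eval] using (h hab).le) hab
  simpa [-Fin.natAdd_eq_addNat, SpaceTerm.eval] using this

theorem distVal_realize_eq_zero (hM : IsMetricStructure M d) {f : M → U}
    (hf : IsFElementary L I f) {α : Type*} (t : L.home.Term α) {a b : α → U}
    (hab : ∀ i, distVal d (a i) (b i) = 0) : distVal d (t.realize a) (t.realize b) = 0 := by
  induction t with
  | var i => exact hab i
  | func g ts ih => exact distVal_funMap_eq_zero hM hf g ih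

theorem eval_eq_of_distVal_eq_zero (hM : IsMetricStructure M d) {f : M → U}
    (hf : IsFElementary L I f) {α : Type*} {β : Type*} (t : SpaceTerm L I α β) {a b : α → U}
    (ξ : β → I) (hab : ∀ i, distVal d (a i) (b i) = 0) : t.eval a ξ = t.eval b ξ := by
  induction t with
  | var i => rfl
  | func g ts ih => simp only [SpaceTerm.eval, ih]
  | mixed g ts =>
    exact mixedMap_eq_of_distVal_eq_zero hM hf g fun i => distVal_realize_eq_zero hM hf (ts i) hab

/-- The relation `∼_S` is coordinatewise equality modulo the pseudometric `d`. -/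
theorem simS_iff (hM : IsMetricStructure M d) {f : M → U} (hf : IsFElementary L I f) {n : ℕ}
    {a b : Fin n → U} : SimS L I a b ↔ ∀ i, distVal d (a i) (b i) = 0 := by
  refine ⟨fun h i => ?_, fun h k t c => eval_eq_of_distVal_eq_zero hM hf t _ ?_⟩
  · -- compare the values of `d(x_i, z)` at `z = b_i`
    have := congrArg Subtype.val
      (h 1 (distTerm d (.var (.inl i)) (.var (.inr 0))) fun _ => b i)
    simpa [distVal_self hM hf] using this
  · rintro (i | i)
    · exact h i
    · exact distVal_self hM hf _

/-! ### Cauchy completeness -/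

/-- The formula `d(x, c) ≤ r` in one variable `x`, where `c` is a name. -/
def distLe {A : Type*} (d : L.mixed 1) (c : A) (r : ℝ) : FFormula L I A 1 0 :=
  .mem (m := 0) (fun _ => distTerm d (.var (.inr 0)) (.var (.inl c)))
    ⟨{p | (p 0 : ℝ) ≤ r}, isClosed_le (by fun_prop) (by fun_prop)⟩

/-- The formula `∃ i, ε ≤ d(x_i, c_i)` in the variables `x`, where `c` is a tuple of names. -/
def someDistGe {A : Type*} {n : ℕ} (d : L.mixed 1) (c : Fin (n + 1) → A) (ε : ℝ) :
    FFormula L I A (n + 1) 0 :=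
  .mem (fun i => distTerm d (.var (.inr i)) (.var (.inl (c i))))
    ⟨⋃ i, {p | ε ≤ p i}, isClosed_iUnion_of_finite fun _ =>
      isClosed_le (by fun_prop) (by fun_prop)⟩

theorem realize_distLe {A : Type*} (ρ : A → U) (c : A) (r : ℝ) (a : Fin 1 → U) (ξ : Fin 0 → I) :
    (distLe d c r).Realize ρ a ξ ↔ distVal d (a 0) (ρ c) ≤ r := by
  simp only [distLe, FFormula.Realize, ← SetLike.mem_coe, TopologicalSpace.Closeds.coe_mk,
    Set.mem_ofPred_eq, eval_distTerm, FirstOrder.Language.Term.realize_var, Sum.elim_inr,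
    Sum.elim_inl]

theorem realize_someDistGe {A : Type*} {n : ℕ} (ρ : A → U) (c : Fin (n + 1) → A) (ε : ℝ)
    (a : Fin (n + 1) → U) (ξ : Fin 0 → I) :
    (someDistGe d c ε).Realize ρ a ξ ↔ ∃ i, ε ≤ distVal d (a i) (ρ (c i)) := by
  simp only [someDistGe, FFormula.Realize, ← SetLike.mem_coe, TopologicalSpace.Closeds.coe_mk,
    Set.mem_iUnion, Set.mem_ofPred_eq, eval_distTerm, FirstOrder.Language.Term.realize_var,
    Sum.elim_inr, Sum.elim_inl]

/-- The limits of a `d`-Cauchy sequence in `A` are the realizations of a `∼_S`-invariant Cauchy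
type over `A`, which is consistent by saturation. -/
theorem IsCauchyComplete.isDistComplete (hM : IsMetricStructure M d) {f : M → U}
    (hf : IsFElementary L I f) (hU : IsFSaturated L I U) (hcard : ℵ₀ < #U) {A : Set U}
    (hA : IsCauchyComplete L I A) : IsDistComplete d A := by
  intro s hs
  choose K hK using fun m : ℕ => hs (1 / (m + 1)) Nat.one_div_pos_of_nat
  have tri := distVal_triangle hM hf
  have comm := distVal_comm hM hf
  let p : Set (FFormula L I A 1 0) := Set.range fun m : ℕ => distLe d (s (K m)) (1 / (m + 1))
  have hreal (a : Fin 1 → U) :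
      Realizes p a ↔ ∀ m : ℕ, distVal d (a 0) (s (K m)) ≤ 1 / (m + 1) := by
    simp only [p, Realizes, Set.forall_mem_range, realize_distLe]
  have hsim (a b : Fin 1 → U) : SimS L I a b ↔ distVal d (a 0) (b 0) = 0 := by
    rw [simS_iff hM hf, Fin.forall_fin_one]
  have hinv {a b : Fin 1 → U} (hab : distVal d (a 0) (b 0) = 0) (ha : Realizes p a) :
      Realizes p b := by
    refine (hreal b).2 fun m => (tri _ (a 0) _).trans ?_
    rw [comm, hab, zero_add]
    exact (hreal a).1 ha m
  have hp : IsCauchyType p := by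
    refine ⟨?_, fun a b ha hb => ?_⟩
    · obtain ⟨a, η, -, -, ha⟩ := hU.exists_realize hcard (ρ := fun m => (s (K m) : U))
        ((Set.countable_range _).le_aleph0.trans_lt hcard) (fun _ => s 0) Fin.elim0 ∅ ∅
        (fun m : ℕ => distLe d m (1 / (m + 1))) fun t => by
          refine ⟨fun _ => s (t.sup K), Fin.elim0, by simp, by simp, fun m hm => ?_⟩
          exact (realize_distLe _ _ _ _ _).2 (hK m _ (Finset.le_sup hm) _ le_rfl).le
      exact ⟨a, (hreal a).2 fun m => (realize_distLe (fun m => (s (K m) : U)) m _ a η).1 (ha m)⟩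
    · refine (hsim a b).2 (le_antisymm ?_ (distVal_nonneg _ _))
      have hle (m : ℕ) : distVal d (a 0) (b 0) ≤ 1 / (m + 1) + 1 / (m + 1) := by
        refine (tri _ (s (K m)) _).trans (add_le_add ((hreal a).1 ha m) ?_)
        rw [comm]
        exact (hreal b).1 hb m
      refine ge_of_tendsto' (x := atTop) ?_ hle
      simpa using (tendsto_one_div_add_atTop_nhds_zero_nat (𝕜 := ℝ)).add
        (tendsto_one_div_add_atTop_nhds_zero_nat (𝕜 := ℝ))
  obtain ⟨b, hb⟩ := hA 1 le_rfl p hp fun a b hab =>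
    ⟨hinv ((hsim a b).1 hab), hinv (comm (a 0) (b 0) ▸ (hsim a b).1 hab)⟩
  refine ⟨b 0, fun ε hε => ?_⟩
  obtain ⟨m, hm⟩ := exists_nat_one_div_lt (half_pos hε)
  refine ⟨K m, fun i hi => ?_⟩
  have h₁ := hK m i hi (K m) le_rfl
  have h₂ := (hreal _).1 hb m
  rw [comm] at h₂
  linarith [tri (s i) (s (K m)) (b 0)]

/-- A realization of a Cauchy type over a small model is approximated by tuples of the model. The
thickenings of `p(x)` are inconsistent with `x` being far from `a`, so by saturation a thickening
of a finite part of `p` implies that `x` is near to `a`; that part is realized in the model up to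
thickening. -/
theorem IsCauchyType.exists_near (hM : IsMetricStructure M d) {f : M → U}
    (hf : IsFElementary L I f) (hU : IsFSaturated L I U) (hcard : ℵ₀ < #U)
    {N : L.home.Substructure U} (hN : IsModel I N) (hsmall : #N < #U) {n : ℕ}
    {p : Set (FFormula L I (N : Set U) (n + 1) 0)} (hp : IsCauchyType p)
    {a : Fin (n + 1) → U} (ha : Realizes p a) {ε : ℝ} (hε : 0 < ε) :
    ∃ b : Fin (n + 1) → (N : Set U), ∀ i, distVal d (b i : U) (a i) < ε := by
  classical
  by_contra! hfar
  have hrange : #(Set.range (Subtype.val : ↥(N : Set U) → U)) < #U := by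
    rw [Subtype.range_val]
    exact hsmall
  let ρ : (N : Set U) ⊕ Fin (n + 1) → U := Sum.elim Subtype.val a
  let F : Option (p × ℕ) → FFormula L I ((N : Set U) ⊕ Fin (n + 1)) (n + 1) 0
    | none => someDistGe d Sum.inr ε
    | some q => (q.1.1.thick (1 / (q.2 + 1))).mapNames Sum.inl
  have hnone (y : Fin (n + 1) → U) (η : Fin 0 → I) :
      (F none).Realize ρ y η ↔ ∃ i, ε ≤ distVal d (y i) (a i) := realize_someDistGe _ _ _ _ _
  have hsome (q : p × ℕ) (y : Fin (n + 1) → U) (η : Fin 0 → I) :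
      (F (some q)).Realize ρ y η ↔ (q.1.1.thick (1 / (q.2 + 1))).Realize Subtype.val y η :=
    FFormula.realize_mapNames _ _ _ _ _
  obtain ⟨y, η, hy⟩ :
      ∃ (y : Fin (n + 1) → U) (η : Fin 0 → I), ∀ o, (F o).Realize ρ y η := by
    suffices h : ∀ s : Finset (Option (p × ℕ)), ∃ (y : Fin (n + 1) → U) (η : Fin 0 → I),
        ∀ o ∈ s, (F o).Realize ρ y η by
      simpa using hU.exists_realize hcard (mk_range_sumElim_lt hcard hrange a) a Fin.elim0 ∅ ∅ F
        (by simpa using h)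
    intro s
    -- finitely many thickenings follow from one thickening of one finite conjunction `Φ`
    let Φ : FFormula L I N (n + 1) 0 := .listAnd (s.eraseNone.toList.map fun q => q.1.1)
    let m := s.eraseNone.sup Prod.snd
    have hΦ : Φ.exHs.Realize (Subtype.val : N → U) Fin.elim0 Fin.elim0 := by
      refine (FFormula.realize_exHs _ _ _).2
        ⟨a, (FFormula.realize_listAnd _ _ _ _).2 fun ψ hψ => ?_⟩
      obtain ⟨q, -, rfl⟩ := List.mem_map.1 hψ
      exact ha _ q.1.2
    have hthick := hN.thick_of_realize (ε := 1 / (m + 1)) Nat.one_div_pos_of_nat hΦ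
    rw [FFormula.thick_exHs, FFormula.realize_exHs] at hthick
    obtain ⟨b, hb⟩ := hthick
    have hb := hN.realize hb
    rw [FFormula.thick_listAnd, FFormula.realize_listAnd] at hb
    refine ⟨Subtype.val ∘ b, Fin.elim0, ?_⟩
    rintro (_ | q) hq
    · exact (hnone _ _).2 (hfar b)
    · have hq : q ∈ s.eraseNone := Finset.mem_eraseNone.2 hq
      refine (hsome q _ _).2 (FFormula.Realize.thick_mono ?_
        (hb (q.1.1.thick (1 / (m + 1))) (List.mem_map_of_mem (List.mem_map.2 ⟨q, by simpa, rfl⟩))))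
      have : q.2 ≤ m := Finset.le_sup hq
      gcongr
  have hpy : Realizes p y := fun ψ hψ => by
    rw [Subsingleton.elim Fin.elim0 η]
    exact hU.realize_of_forall_thick hcard hrange fun m => (hsome (⟨ψ, hψ⟩, m) y η).1 (hy (some _))
  obtain ⟨i, hi⟩ := (hnone y η).1 (hy none)
  exact hε.not_ge ((simS_iff hM hf).1 (hp.2 y a hpy ha) i ▸ hi)

/-- The approximations of a realization `a` of a Cauchy type by tuples of `N` form coordinatewise
Cauchy sequences, whose limits are `∼_S`-equivalent to `a`. -/
theorem IsDistComplete.isCauchyComplete (hM : IsMetricStructure M d) {f : M → U}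
    (hf : IsFElementary L I f) (hU : IsFSaturated L I U) (hcard : ℵ₀ < #U)
    {N : L.home.Substructure U} (hN : IsModel I N) (hsmall : #N < #U)
    (h : IsDistComplete d (N : Set U)) : IsCauchyComplete L I (N : Set U) := by
  rintro (_ | n) hn p hp hinv
  · exact absurd hn (by simp)
  obtain ⟨a, ha⟩ := hp.1
  have tri := distVal_triangle hM hf
  have comm := distVal_comm hM hf
  choose b hb using fun m : ℕ =>
    hp.exists_near hM hf hU hcard hN hsmall ha (ε := 1 / (m + 1)) Nat.one_div_pos_of_nat
  have hlim (i : Fin (n + 1)) (ε : ℝ) (hε : 0 < ε) :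
      ∃ K : ℕ, ∀ m ≥ K, distVal d (b m i : U) (a i) < ε := by
    obtain ⟨K, hK⟩ := exists_nat_one_div_lt hε
    refine ⟨K, fun m hm => (hb m i).trans_le (le_trans ?_ hK.le)⟩
    gcongr
  choose c hc using fun i => h (fun m => b m i) fun ε hε => by
    obtain ⟨K, hK⟩ := hlim i (ε / 2) (half_pos hε)
    refine ⟨K, fun m hm m' hm' => ?_⟩
    have h' := hK m' hm'
    rw [comm] at h'
    linarith [hK m hm, tri (b m i) (a i) (b m' i)]
  refine ⟨c, (hinv a _ ((simS_iff hM hf).2 fun i => ?_)).1 ha⟩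
  refine le_antisymm (le_of_forall_pos_le_add fun ε hε => ?_) (distVal_nonneg _ _)
  obtain ⟨K, hK⟩ := hlim i (ε / 2) (half_pos hε)
  obtain ⟨K', hK'⟩ := hc i (ε / 2) (half_pos hε)
  have h₁ := hK _ (le_max_left K K')
  have h₂ := hK' _ (le_max_right K K')
  rw [comm] at h₁
  linarith [tri (a i) (b (max K K') i) (c i)]

end Metric

end SpaceLanguage

theorem mainTheorem12 {L : SpaceLanguage.{u, v, w}} (d : L.mixed 1)
    {M : Type x} [MetricSpace M] [L.home.Structure M] [L.MixedStructure unitInterval M]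
    (hM : SpaceLanguage.IsMetricStructure M d)
    {U : Type y} [L.home.Structure U] [L.MixedStructure unitInterval U]
    (hUM : ∃ f : M → U, SpaceLanguage.IsFElementary L unitInterval f)
    (hU : SpaceLanguage.IsFSaturated L unitInterval U) (hcard : ℵ₀ < #U)
    (N : L.home.Substructure U) (hN : SpaceLanguage.IsModel unitInterval N)
    (hsmall : #N < #U ∨ N = ⊤) :
    SpaceLanguage.IsCauchyComplete L unitInterval (N : Set U) ↔
      SpaceLanguage.IsDistComplete d (N : Set U) := by
  obtain ⟨f, hf⟩ := hUM
  refine ⟨fun h => h.isDistComplete hM hf hU hcard, fun h => ?_⟩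
  rcases hsmall with hsmall | rfl
  · exact h.isCauchyComplete hM hf hU hcard hN hsmall
  · -- every consistent type over `U` itself is realized in `U`
    intro n _ p hp _
    obtain ⟨a, ha⟩ := hp.1
    exact ⟨fun i => ⟨a i, trivial⟩, ha⟩
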